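/- Let $I$ be a nonempty finite set with standard basis $(\alpha_i)_{i\in I}$ of $\mathbb Z^I$. A *generalized Cartan matrix* is an integer matrix $(c_{ij})_{i,j\in I}$ with $c_{ii}=2$, $c_{ij}\le 0$ for $i\ne j$, and $c_{ij}=0\Rightarrow c_{ji}=0$. A *Cartan scheme* $\mathcal C$ consists of a nonempty set $A$ of objects, maps $\rho_i:A\to A$ ($i\in I$) and generalized Cartan matrices $C^a=(c^a_{ij})_{i,j\in I}$ ($a\in A$) such that $\rho_i^2=\mathrm{id}$ and $c^{\rho_i(a)}_{ij}=c^a_{ij}$ for all $i,j\in I$, $a\in A$; its *rank* is $|I|$. Let $\sigma_i^a\in\mathrm{Aut}(\mathbb Z^I)$ be given by $\sigma_i^a(\alpha_j)=\alpha_j-c^a_{ij}\alpha_i$. The *Weyl groupoid* has object set $A$, and its morphisms $a\to b$ are the automorphisms of $\mathbb Z^I$ that are (possibly empty) compositions of the maps $\sigma_i^d$, regarded as morphisms $d\to\rho_i(d)$, leading from $a$ to $b$. $\mathcal C$ is *connected* if $\mathrm{Hom}(a,b)\neq\emptyset$ for all $a,b\in A$, *simply connected* if $\mathrm{Hom}(a,a)=\{\mathrm{id}_a\}$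 for all $a\in A$, and *irreducible* if every $C^a$ is indecomposable, i.e. $I$ is never a disjoint union of nonempty sets $J,K$ with $c^a_{jk}=c^a_{kj}=0$ for all $j\in J$, $k\in K$. The set of *real roots* at $a$ is $R^a=\{w(\alpha_j)\mid b\in A,\ w\in\mathrm{Hom}(b,a),\ j\in I\}$. The real roots form a *finite root system of type $\mathcal C$* if for all $a\in A$ and $i,j\in I$: $R^a$ is finite; $R^a=R^a_+\cup -R^a_+$ with $R^a_+=R^a\cap\mathbb N_0^I$; $R^a\cap\mathbb Z\alpha_i=\{\alpha_i,-\alpha_i\}$; $\sigma_i^a(R^a)=R^{\rho_i(a)}$; and, if $i\neq j$, $(\rho_i\rho_j)^{m}(a)=a$ with $m=|R^a\cap(\mathbb N_0\alpha_i+\mathbb N_0\alpha_j)|$. The *object change diagram* of $\mathcal C$ is the undirected graph with vertex set $A$ that has, for all $i\in I$ and $a\in A$ with $\rho_i(a)\neq a$, precisely one edge labelled $i$ between $a$ and $\rho_i(a)$, and no other edges. Its ($2$-dimensional) *faces* are the equivalence classes of triples $(i,j,a)\in I\times I\times A$ with $i\ne j$, under the equivalence relation generated by: $(i,j,a)\sim(i',j',b)$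 if $\{i,j\}=\{i',j'\}$ and $b=(\rho_j\rho_i)^m(a)$ or $b=\rho_i(\rho_j\rho_i)^m(a)$ for some $m\in\mathbb N_0$. **Proposition.** Let $\mathcal C$ be an irreducible, connected, simply connected Cartan scheme of rank three whose real roots form a finite root system of type $\mathcal C$. Then the numbers $e$ of vertices, $k$ of edges and $f$ of faces of the object change diagram of $\mathcal C$ are finite, and $e-k+f=2$. -/

import Mathlib

open CategoryTheory Pointwise Graph

/-- A generalized Cartan matrix with integer entries. -/
structure IsGeneralizedCartanMatrix {I : Type*} (c : Matrix I I ℤ) : Prop where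
  diag : ∀ i, c i i = 2
  nonpos : ∀ j k, j ≠ k → c j k ≤ 0
  zero_symm : ∀ i j, c i j = 0 → c j i = 0

/-- A matrix is indecomposable if the index set is not the disjoint union of two nonempty
subsets `J` and `Jᶜ` with vanishing off-diagonal blocks. -/
def IsIndecomposableMatrix {I : Type*} (c : Matrix I I ℤ) : Prop :=
  ¬ ∃ J : Set I, J.Nonempty ∧ Jᶜ.Nonempty ∧ ∀ j ∈ J, ∀ k ∈ Jᶜ, c j k = 0 ∧ c k j = 0

/-- A Cartan scheme with index set `I` and set of objects `A`. -/
structure CartanScheme (I A : Type*) [Fintype I] [Nonempty I] [Nonempty A] where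
  /-- The object change maps `ρ i : A → A`. -/
  ρ : I → A → A
  /-- The Cartan matrix at each object. -/
  cartan : A → Matrix I I ℤ
  isGCM : ∀ a, IsGeneralizedCartanMatrix (cartan a)
  ρ_ρ : ∀ i a, ρ i (ρ i a) = a
  cartan_ρ : ∀ a i j, cartan (ρ i a) i j = cartan a i j

namespace CartanScheme

variable {I A : Type*} [Fintype I] [DecidableEq I] [Nonempty I] [Nonempty A]

/-- The standard basis vector `α i` of `ℤ^I`. -/
def α (i : I) : I → ℤ := Pi.single i 1

/-- The linear form `α j ↦ c^a_{ij}` on `ℤ^I`. -/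
def coroot (C : CartanScheme I A) (a : A) (i : I) : Module.Dual ℤ (I → ℤ) :=
  ∑ j, C.cartan a i j • LinearMap.proj j

theorem coroot_α (C : CartanScheme I A) (a : A) (i j : I) :
    C.coroot a i (α j) = C.cartan a i j := by
  simp [coroot, α, LinearMap.sum_apply, Pi.single_apply]

/-- The automorphism `σ_i^a` of `ℤ^I`. -/
def σ (C : CartanScheme I A) (a : A) (i : I) : (I → ℤ) ≃ₗ[ℤ] (I → ℤ) :=
  Module.reflection (x := α i) (f := C.coroot a i)
    (by rw [coroot_α, (C.isGCM a).diag])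

theorem σ_α (C : CartanScheme I A) (a : A) (i j : I) :
    C.σ a i (α j) = α j - C.cartan a i j • α i := by
  rw [σ, Module.reflection_apply, coroot_α]

/-- `C.IsMorphism a b w` says that `w` is a (possibly empty) composition
`σ_{i_1} ⋯ σ_{i_k}^a` that starts at the object `a` and ends at the object `b`. -/
inductive IsMorphism (C : CartanScheme I A) (a : A) : A → ((I → ℤ) ≃ₗ[ℤ] (I → ℤ)) → Prop
  | id : IsMorphism C a a 1
  | step (b : A) (w : (I → ℤ) ≃ₗ[ℤ] (I → ℤ)) (i : I) :
      IsMorphism C a b w → IsMorphism C a (C.ρ i b) (C.σ b i * w)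

/-- The objects of the Weyl groupoid are the elements of `A`. -/
def WeylGroupoid (_C : CartanScheme I A) : Type _ := A

theorem IsMorphism.comp {C : CartanScheme I A} {a b d : A} {v w : (I → ℤ) ≃ₗ[ℤ] (I → ℤ)}
    (hv : C.IsMorphism a b v) (hw : C.IsMorphism b d w) : C.IsMorphism a d (w * v) := by
  induction hw with
  | id => simpa using hv
  | step e u i _ ih => rw [mul_assoc]; exact .step e _ i ih

theorem σ_ρ (C : CartanScheme I A) (a : A) (i : I) : C.σ (C.ρ i a) i = C.σ a i := by
  have h : C.coroot (C.ρ i a) i = C.coroot a i := by simp [coroot, C.cartan_ρ]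
  ext1 x
  simp only [σ, Module.reflection_apply, h]

theorem IsMorphism.inv {C : CartanScheme I A} {a b : A} {w : (I → ℤ) ≃ₗ[ℤ] (I → ℤ)}
    (hw : C.IsMorphism a b w) : C.IsMorphism b a w⁻¹ := by
  induction hw with
  | id => simpa using IsMorphism.id
  | step e u i _ ih =>
    have h := IsMorphism.step (C := C) (C.ρ i e) 1 i .id
    rw [C.ρ_ρ, mul_one, σ_ρ] at h
    have h2 : (C.σ e i)⁻¹ = C.σ e i := Module.reflection_inv _
    rw [mul_inv_rev, h2]
    exact h.comp ih

/-- The Weyl groupoid: a morphism `a ⟶ b` is an automorphism of `ℤ^I` (together with its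
source and target) that is a composition of maps `σ_i` leading from `a` to `b`. -/
instance (C : CartanScheme I A) : Groupoid C.WeylGroupoid where
  Hom a b := {w : (I → ℤ) ≃ₗ[ℤ] (I → ℤ) // C.IsMorphism a b w}
  id _ := ⟨1, .id⟩
  comp v w := ⟨w.1 * v.1, v.2.comp w.2⟩
  id_comp _ := Subtype.ext (mul_one _)
  comp_id _ := Subtype.ext (one_mul _)
  assoc _ _ _ := Subtype.ext (mul_assoc _ _ _).symm
  inv w := ⟨w.1⁻¹, w.2.inv⟩
  inv_comp _ := Subtype.ext (mul_inv_cancel _)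
  comp_inv _ := Subtype.ext (inv_mul_cancel _)

/-- Any two objects of the Weyl groupoid are joined by a morphism. -/
def IsConnected (C : CartanScheme I A) : Prop :=
  ∀ a b : C.WeylGroupoid, Nonempty (a ⟶ b)

/-- `Hom(a, a) = {id_a}` for all objects `a`. -/
def IsSimplyConnected (C : CartanScheme I A) : Prop :=
  ∀ (a : C.WeylGroupoid) (w : a ⟶ a), w = 𝟙 a

/-- All Cartan matrices are indecomposable. -/
def IsIrreducible (C : CartanScheme I A) : Prop :=
  ∀ a, IsIndecomposableMatrix (C.cartan a)

/-- The set of real roots at `a`. -/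
def realRoots (C : CartanScheme I A) (a : A) : Set (I → ℤ) :=
  {β | ∃ (b : C.WeylGroupoid) (w : b ⟶ (show C.WeylGroupoid from a)) (j : I), β = w.1 (α j)}

/-- The number `m_{i,j}` of elements of `S ∩ (ℕ₀ α_i + ℕ₀ α_j)`, used for finite sets only. -/
noncomputable def rankTwoCount (S : Set (I → ℤ)) (i j : I) : ℕ :=
  (S ∩ {x | ∃ p q : ℕ, x = p • α i + q • α j}).ncard

/-- The family `R` is a root system of type `C`. -/
structure IsRootSystem (C : CartanScheme I A) (R : A → Set (I → ℤ)) : Prop where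
  pos_or_neg : ∀ a, R a = (R a ∩ {x | 0 ≤ x}) ∪ -(R a ∩ {x | 0 ≤ x})
  multiples : ∀ a i, R a ∩ {x | ∃ n : ℤ, x = n • α i} = {α i, -α i}
  image_σ : ∀ a i, C.σ a i '' R a = R (C.ρ i a)
  coxeter : ∀ a i j, i ≠ j → (R a ∩ {x | ∃ p q : ℕ, x = p • α i + q • α j}).Finite →
    (C.ρ i ∘ C.ρ j)^[rankTwoCount (R a) i j] a = a

/-- The family `R` is a finite root system of type `C`. -/
structure IsFiniteRootSystem (C : CartanScheme I A) (R : A → Set (I → ℤ)) : Prop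
    extends C.IsRootSystem R where
  finite : ∀ a, (R a).Finite

/-- The object change diagram: an undirected graph whose vertices are the elements of `A`, with
precisely one edge labelled `i`, called `(i, {a, ρ_i(a)})`, between `a` and `ρ_i(a)`
whenever `ρ_i(a) ≠ a`. -/
def objectChangeDiagram (C : CartanScheme I A) : Graph A (I × Sym2 A) where
  vertexSet := Set.univ
  IsLink e a b := C.ρ e.1 a = b ∧ a ≠ b ∧ e.2 = s(a, b)
  isLink_symm e _ := ⟨fun a b ⟨h, hne, he⟩ =>
    ⟨by rw [← h, C.ρ_ρ], hne.symm, by rw [he, Sym2.eq_swap]⟩⟩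
  eq_or_eq_of_isLink_of_isLink e x y v w h h' := by
    have := h.2.2.symm.trans h'.2.2
    rw [Sym2.eq_iff] at this
    tauto
  left_mem_of_isLink _ _ _ _ := Set.mem_univ _

/-- The triples `(i, j, a)` with `i ≠ j`, which represent the faces. -/
abbrev FaceTriple (I A : Type*) : Type _ := {t : I × I × A // t.1 ≠ t.2.1}

/-- `(i, j, a)` and `(i', j', b)` represent the same face if `{i, j} = {i', j'}` and `b` is
one of the objects `(ρ_j ρ_i)^m(a)`, `ρ_i (ρ_j ρ_i)^m(a)` with `m ≥ 0`. -/
def SameFace (C : CartanScheme I A) (s t : FaceTriple I A) : Prop :=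
  ({s.1.1, s.1.2.1} : Set I) = {t.1.1, t.1.2.1} ∧
    ∃ m : ℕ, t.1.2.2 = (C.ρ s.1.2.1 ∘ C.ρ s.1.1)^[m] s.1.2.2 ∨
      t.1.2.2 = C.ρ s.1.1 ((C.ρ s.1.2.1 ∘ C.ρ s.1.1)^[m] s.1.2.2)

/-- The (2-dimensional) faces of the object change diagram: equivalence classes of triples. The
generated equivalence relation is `SameFace` itself when each `ρ_j ρ_i` has finite orbits. -/
def Face (C : CartanScheme I A) : Type _ := Quotient (Relation.EqvGen.setoid C.SameFace)

end CartanScheme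

namespace CartanScheme

set_option linter.unusedSectionVars false

variable {I A : Type*} [Fintype I] [DecidableEq I] [Nonempty I] [Nonempty A]

/-! This is a discrete Morse argument. Fix an object `b` and transport the sum of coordinates from
`b` to every object along the Weyl groupoid. Simple connectivity makes this well defined, and it
vanishes on no root. Each pair of object and label is then an ascent or a descent.

Crossing a descent removes exactly one negative-height positive root, so descending terminates. Two
descents at one object are confluent by the Coxeter relation, so every residue, for any set of
labels, has a unique minimum (`exists_minimal`). Hence an edge can be counted at its lower end and a
face at its lowest vertex. An object with `s` ascents contributes `1 - s + s.choose 2`, which for `s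
≤ 3` is `1` if `s = 0` or `s = 3` and `0` otherwise. Connectedness gives exactly one object of each
of these two kinds: the minimum for the height and the minimum for its negative. The total is 2. -/

/-- A family of linear forms on `ℤ^I`, one for each object, that is compatible with the
maps `σ` and does not vanish on the roots. -/
structure IsHeight (C : CartanScheme I A) (R : A → Set (I → ℤ))
    (h : A → Module.Dual ℤ (I → ℤ)) : Prop where
  apply_σ : ∀ a i x, h (C.ρ i a) (C.σ a i x) = h a x
  ne_zero : ∀ a, ∀ β ∈ R a, h a β ≠ 0

theorem IsHeight.neg {C : CartanScheme I A} {R : A → Set (I → ℤ)}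
    {h : A → Module.Dual ℤ (I → ℤ)} (hh : C.IsHeight R h) : C.IsHeight R (-h) where
  apply_σ a i x := by simp [hh.apply_σ]
  ne_zero a β hβ := by simpa using hh.ne_zero a β hβ

/-! ### Reflections and positivity of roots. -/

theorem σ_apply (C : CartanScheme I A) (a : A) (i : I) (x : I → ℤ) :
    C.σ a i x = x - C.coroot a i x • α i := by
  rw [σ, Module.reflection_apply]

theorem σ_σ (C : CartanScheme I A) (a : A) (i : I) (x : I → ℤ) :
    C.σ a i (C.σ a i x) = x :=
  Module.involutive_reflection _ x

theorem σ_α_self (C : CartanScheme I A) (a : A) (i : I) : C.σ a i (α i) = -α i := by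
  rw [σ_α, (C.isGCM a).diag]; module

theorem σ_apply_of_ne (C : CartanScheme I A) (a : A) {i k : I} (hk : k ≠ i) (x : I → ℤ) :
    C.σ a i x k = x k := by
  simp [σ_apply, α, hk]

theorem α_nonneg (i : I) : (0 : I → ℤ) ≤ α i := by
  simp [α]

theorem not_neg_α_nonneg (i : I) : ¬ (0 : I → ℤ) ≤ -α i := by
  intro h
  have := h i
  simp [α] at this

theorem eq_sum_α (x : I → ℤ) : x = ∑ i, x i • α i := by
  simpa [α] using pi_eq_sum_univ' x

/-- A nonnegative vector supported in a set of basis vectors with positive values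
has nonnegative value. -/
theorem dual_nonneg {f : Module.Dual ℤ (I → ℤ)} {x : I → ℤ} (hx : 0 ≤ x) {J : Finset I}
    (hJ : ∀ k ∉ J, x k = 0) (hf : ∀ i ∈ J, 0 < f (α i)) : 0 ≤ f x := by
  rw [eq_sum_α x, map_sum]
  refine Finset.sum_nonneg fun i _ => ?_
  rw [map_smul, smul_eq_mul]
  by_cases hi : i ∈ J
  · exact mul_nonneg (hx i) (hf i hi).le
  · simp [hJ i hi]

section RootSystem

variable {C : CartanScheme I A} {R : A → Set (I → ℤ)}

theorem IsRootSystem.α_mem (hR : C.IsRootSystem R) (a : A) (i : I) : α i ∈ R a := by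
  have : α i ∈ R a ∩ {x | ∃ n : ℤ, x = n • α i} := by
    rw [hR.multiples]; simp
  exact this.1

theorem IsRootSystem.nonneg_or_nonpos (hR : C.IsRootSystem R) {a : A} {β : I → ℤ}
    (hβ : β ∈ R a) : 0 ≤ β ∨ β ≤ 0 := by
  rw [hR.pos_or_neg a] at hβ
  rcases hβ with hβ | hβ
  · exact .inl hβ.2
  · exact .inr (by simpa using hβ.2)

theorem IsRootSystem.σ_mem (hR : C.IsRootSystem R) {a : A} {β : I → ℤ}
    (hβ : β ∈ R a) (i : I) : C.σ a i β ∈ R (C.ρ i a) :=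
  hR.image_σ a i ▸ Set.mem_image_of_mem _ hβ

/-- The reflection changes only the `i`-th coordinate, so a positive root sent to a negative one is
supported at `i`, hence is `α i`. -/
theorem IsRootSystem.σ_nonneg (hR : C.IsRootSystem R) {a : A} {β : I → ℤ} {i : I}
    (hβ : β ∈ R a) (hpos : 0 ≤ β) (hne : β ≠ α i) : 0 ≤ C.σ a i β := by
  refine (hR.nonneg_or_nonpos (hR.σ_mem hβ i)).resolve_right fun hneg => ?_
  have h0 : ∀ k, k ≠ i → β k = 0 := fun k hk =>
    le_antisymm (by simpa [σ_apply_of_ne C a hk] using hneg k) (hpos k)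
  have hmem : β ∈ R a ∩ {x | ∃ n : ℤ, x = n • α i} := by
    refine ⟨hβ, β i, funext fun k => ?_⟩
    by_cases hk : k = i
    · subst hk; simp [α]
    · simp [α, hk, h0 k hk]
  rw [hR.multiples] at hmem
  rcases hmem with h | h
  · exact hne h
  · exact not_neg_α_nonneg i (h ▸ hpos)

end RootSystem

/-! ### Inversions, descents and alternating walks. -/

/-- The positive roots at `a` supported in `J` with negative height. -/
def inversions (R : A → Set (I → ℤ)) (h : A → Module.Dual ℤ (I → ℤ)) (J : Finset I) (a : A) :
    Set (I → ℤ) :=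
  {β | β ∈ R a ∧ 0 ≤ β ∧ (∀ k ∉ J, β k = 0) ∧ h a β < 0}

/-- `b` is obtained from `a` by a reflection in `J` that decreases the length. -/
def Descent (C : CartanScheme I A) (h : A → Module.Dual ℤ (I → ℤ)) (J : Finset I)
    (a b : A) : Prop :=
  ∃ i ∈ J, h a (α i) < 0 ∧ b = C.ρ i a

/-- The object reached from `b` by a walk of `n` steps with labels `i, j, i, j, …`. -/
def alternatingWalk (C : CartanScheme I A) : ℕ → I → I → A → A
  | 0, _, _, b => b
  | n + 1, i, j, b => C.alternatingWalk n j i (C.ρ i b)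

theorem alternatingWalk_succ (C : CartanScheme I A) (n : ℕ) (i j : I) (b : A) :
    C.alternatingWalk (n + 1) i j b =
      C.ρ (if Even n then i else j) (C.alternatingWalk n i j b) := by
  induction n generalizing i j b with
  | zero => simp [alternatingWalk]
  | succ n ih =>
    rw [alternatingWalk, ih]
    by_cases hn : Even n <;> simp [alternatingWalk, hn, Nat.even_add_one]

theorem alternatingWalk_two_mul (C : CartanScheme I A) (m : ℕ) (i j : I) (b : A) :
    C.alternatingWalk (2 * m) i j b = (C.ρ j ∘ C.ρ i)^[m] b := by
  induction m generalizing b with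
  | zero => rfl
  | succ m ih => simp [Nat.mul_succ, alternatingWalk, ih]

/-- The walk of length `2 * m` is closed and ends with label `j`. Traversed backwards from `a` it is
the walk starting with `j`, and both directions meet halfway. -/
theorem alternatingWalk_comm (C : CartanScheme I A) {m : ℕ} {i j : I} {a : A}
    (h : (C.ρ j ∘ C.ρ i)^[m] a = a) :
    C.alternatingWalk m i j a = C.alternatingWalk m j i a := by
  have key : ∀ k ≤ 2 * m, C.alternatingWalk (2 * m - k) i j a = C.alternatingWalk k j i a := by
    intro k
    induction k with
    | zero => intro _; rw [Nat.sub_zero, alternatingWalk_two_mul, h]; rfl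
    | succ k ih =>
      intro hk
      have h1 := ih (by omega)
      obtain ⟨n, hn⟩ : ∃ n, 2 * m = n + (k + 1) := ⟨2 * m - (k + 1), by omega⟩
      rw [alternatingWalk_succ, ← h1, show 2 * m - k = n + 1 by omega,
        show 2 * m - (k + 1) = n by omega, alternatingWalk_succ]
      have hpar : Even n ↔ ¬ Even k := by grind
      by_cases hk : Even k <;> simp [hpar, hk, C.ρ_ρ]
  simpa [show 2 * m - m = m by omega] using key m (by omega)

/-! ### Confluence of descents and minima of residues. -/

section Height

variable {C : CartanScheme I A} {R : A → Set (I → ℤ)} {h : A → Module.Dual ℤ (I → ℤ)}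

theorem IsHeight.apply_ρ_α (hh : C.IsHeight R h) (a : A) (i : I) :
    h (C.ρ i a) (α i) = -h a (α i) := by
  have := hh.apply_σ a i (α i)
  rw [σ_α_self, map_neg] at this
  omega

theorem inversions_finite (hR : C.IsFiniteRootSystem R) (J : Finset I) (a : A) :
    (inversions R h J a).Finite :=
  (hR.finite a).subset fun _ hβ => hβ.1

theorem σ_mem_inversions (hR : C.IsRootSystem R) (hh : C.IsHeight R h) {J : Finset I} {i : I}
    (hi : i ∈ J) {a : A} {β : I → ℤ} (hβ : β ∈ inversions R h J a) (hne : β ≠ α i) :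
    C.σ a i β ∈ inversions R h J (C.ρ i a) := by
  refine ⟨hR.σ_mem hβ.1 i, hR.σ_nonneg hβ.1 hβ.2.1 hne, fun k hk => ?_, ?_⟩
  · rw [σ_apply_of_ne C a (by rintro rfl; exact hk hi), hβ.2.2.1 k hk]
  · rw [hh.apply_σ]; exact hβ.2.2.2

/-- The reflection permutes the positive roots other than the simple one and preserves height, so
only the inversion `α i` is lost. -/
theorem ncard_inversions_ρ (hR : C.IsFiniteRootSystem R) (hh : C.IsHeight R h) {J : Finset I}
    {i : I} (hi : i ∈ J) {a : A} (hneg : h a (α i) < 0) :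
    (inversions R h J (C.ρ i a)).ncard + 1 = (inversions R h J a).ncard := by
  have hmem : α i ∈ inversions R h J a :=
    ⟨hR.α_mem a i, α_nonneg i, fun k hk => by
      have : k ≠ i := by rintro rfl; exact hk hi
      simp [α, this], hneg⟩
  have himg : C.σ a i '' (inversions R h J a \ {α i}) = inversions R h J (C.ρ i a) := by
    ext β
    constructor
    · rintro ⟨γ, ⟨hγ, hne⟩, rfl⟩
      exact σ_mem_inversions hR.toIsRootSystem hh hi hγ hne
    · intro hβ
      have hne : β ≠ α i := by
        rintro rfl
        have := hβ.2.2.2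
        rw [hh.apply_ρ_α] at this
        omega
      have h1 := σ_mem_inversions hR.toIsRootSystem hh hi hβ hne
      rw [C.ρ_ρ, C.σ_ρ] at h1
      refine ⟨C.σ a i β, ⟨h1, fun h2 => ?_⟩, C.σ_σ a i β⟩
      have h3 : β = -α i := by
        rw [← C.σ_σ a i β, show C.σ a i β = α i from h2, σ_α_self]
      exact not_neg_α_nonneg i (h3 ▸ hβ.2.1)
  rw [← himg, Set.ncard_image_of_injective _ (C.σ a i).injective,
    Set.ncard_sdiff_singleton_add_one hmem (inversions_finite hR J a)]

theorem inversions_eq_empty {J : Finset I} {a : A} (hJ : ∀ i ∈ J, 0 < h a (α i)) :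
    inversions R h J a = ∅ :=
  Set.eq_empty_of_forall_notMem fun _ hβ =>
    (dual_nonneg hβ.2.1 hβ.2.2.1 hJ).not_gt hβ.2.2.2

theorem IsHeight.lt_or_gt (hR : C.IsRootSystem R) (hh : C.IsHeight R h) (a : A) (i : I) :
    h a (α i) < 0 ∨ 0 < h a (α i) :=
  lt_or_gt_of_ne (hh.ne_zero a _ (hR.α_mem a i))

/-- After a descent along `i`, the label `i` is an ascent. If inversions remain in the rank-two
span, `j` must be a descent, so the labels alternate until all `n` inversions are used up. -/
theorem reflTransGen_descent_alternatingWalk (hR : C.IsFiniteRootSystem R)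
    (hh : C.IsHeight R h) {J : Finset I} (n : ℕ) {i j : I} (hi : i ∈ J) (hj : j ∈ J) {b : A}
    (hlen : (inversions R h {i, j} b).ncard = n) (hneg : 0 < n → h b (α i) < 0) :
    Relation.ReflTransGen (C.Descent h J) b (C.alternatingWalk n i j b) := by
  induction n generalizing i j b with
  | zero => exact .refl
  | succ n ih =>
    have hb := hneg n.succ_pos
    have hstep := ncard_inversions_ρ hR hh (J := {i, j}) (i := i) (by simp) hb
    refine .head ⟨i, hi, hb, rfl⟩ (ih hj hi (by rw [Finset.pair_comm]; omega) fun hn => ?_)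
    refine (hh.lt_or_gt hR.toIsRootSystem _ j).resolve_right fun hpos => ?_
    have h0 : inversions R h {i, j} (C.ρ i b) = ∅ := by
      refine inversions_eq_empty fun k hk => ?_
      rcases Finset.mem_insert.1 hk with rfl | hk
      · rw [hh.apply_ρ_α]; omega
      · rw [Finset.mem_singleton.1 hk]; exact hpos
    rw [h0, Set.ncard_empty] at hstep
    omega

/-- When both labels are descents, every positive root in their span has negative height. This
identifies the number of inversions with the Coxeter exponent. -/
theorem inversions_pair (hh : C.IsHeight R h) {i j : I} (hij : i ≠ j) {a : A}
    (hi : h a (α i) < 0) (hj : h a (α j) < 0) :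
    inversions R h {i, j} a = R a ∩ {x | ∃ p q : ℕ, x = p • α i + q • α j} := by
  ext β
  constructor
  · rintro ⟨hβ, hpos, hsupp, -⟩
    refine ⟨hβ, (β i).toNat, (β j).toNat, funext fun k => ?_⟩
    have h1 := Int.toNat_of_nonneg (hpos i)
    have h2 := Int.toNat_of_nonneg (hpos j)
    by_cases hk : k = i
    · subst hk; simpa [α, hij] using h1.symm
    · by_cases hk' : k = j
      · subst hk'; simpa [α, hk] using h2.symm
      · simp [α, hk, hk', hsupp k (by simp [hk, hk'])]
  · rintro ⟨hβ, p, q, rfl⟩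
    have hpos : (0 : I → ℤ) ≤ p • α i + q • α j :=
      add_nonneg (nsmul_nonneg (α_nonneg i) p) (nsmul_nonneg (α_nonneg j) q)
    refine ⟨hβ, hpos, fun k hk => ?_, lt_of_le_of_ne ?_ (hh.ne_zero a _ hβ)⟩
    · simp only [Finset.mem_insert, Finset.mem_singleton, not_or] at hk
      simp [α, hk.1, hk.2]
    · rw [map_add, map_nsmul, map_nsmul]
      exact add_nonpos (nsmul_nonpos hi.le p) (nsmul_nonpos hj.le q)

/-- Both alternating walks from `a` descend for as many steps as there are rank-two positive roots,
and the Coxeter relation says that they end at the same object. -/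
theorem descent_locally_confluent (hR : C.IsFiniteRootSystem R) (hh : C.IsHeight R h)
    {J : Finset I} {i j : I} (hi : i ∈ J) (hj : j ∈ J) {a : A} (hai : h a (α i) < 0)
    (haj : h a (α j) < 0) :
    ∃ c, Relation.ReflTransGen (C.Descent h J) (C.ρ i a) c ∧
      Relation.ReflTransGen (C.Descent h J) (C.ρ j a) c := by
  by_cases hij : i = j
  · subst hij; exact ⟨_, .refl, .refl⟩
  have key : ∀ {i j : I}, i ∈ J → j ∈ J → i ≠ j → h a (α i) < 0 → h a (α j) < 0 →
      ∃ n, (inversions R h {i, j} a).ncard = n + 1 ∧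
        Relation.ReflTransGen (C.Descent h J) (C.ρ i a) (C.alternatingWalk (n + 1) i j a) := by
    intro i j hi hj hij hai haj
    have hstep := ncard_inversions_ρ hR hh (J := {i, j}) (i := i) (by simp) hai
    refine ⟨_, hstep.symm, ?_⟩
    refine reflTransGen_descent_alternatingWalk hR hh _ hj hi (by rw [Finset.pair_comm])
      fun hn => ?_
    refine (hh.lt_or_gt hR.toIsRootSystem _ j).resolve_right fun hpos => ?_
    have h0 : inversions R h {i, j} (C.ρ i a) = ∅ := by
      refine inversions_eq_empty fun k hk => ?_
      rcases Finset.mem_insert.1 hk with rfl | hk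
      · rw [hh.apply_ρ_α]; omega
      · rw [Finset.mem_singleton.1 hk]; exact hpos
    simp [h0] at hn
  obtain ⟨n, hn, h1⟩ := key hi hj hij hai haj
  obtain ⟨n', hn', h2⟩ := key hj hi (Ne.symm hij) haj hai
  rw [Finset.pair_comm, hn] at hn'
  obtain rfl : n = n' := by omega
  refine ⟨_, h1, ?_⟩
  rwa [alternatingWalk_comm]
  have hcox := hR.coxeter a j i (Ne.symm hij) ((hR.finite a).subset Set.inter_subset_left)
  rwa [rankTwoCount, ← inversions_pair hh (Ne.symm hij) haj hai, Finset.pair_comm, hn] at hcox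

theorem exists_terminal (hR : C.IsFiniteRootSystem R) (hh : C.IsHeight R h) (J : Finset I)
    (a : A) : ∃ t, Relation.ReflTransGen (C.Descent h J) a t ∧ ∀ i ∈ J, 0 < h t (α i) := by
  induction hn : (inversions R h J a).ncard using Nat.strong_induction_on generalizing a with
  | _ n ih =>
    by_cases hJ : ∀ i ∈ J, 0 < h a (α i)
    · exact ⟨a, .refl, hJ⟩
    · push Not at hJ
      obtain ⟨i, hi, hle⟩ := hJ
      have hneg := (hh.lt_or_gt hR.toIsRootSystem a i).resolve_right hle.not_gt
      have hstep := ncard_inversions_ρ hR hh hi hneg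
      obtain ⟨t, ht, hpos⟩ := ih _ (by omega) (C.ρ i a) rfl
      exact ⟨t, .head ⟨i, hi, hneg, rfl⟩ ht, hpos⟩

theorem terminal_eq {J : Finset I} {t b : A} (hpos : ∀ i ∈ J, 0 < h t (α i))
    (ht : Relation.ReflTransGen (C.Descent h J) t b) : b = t := by
  rcases ht.cases_head with rfl | ⟨c, ⟨i, hi, hneg, -⟩, -⟩
  · rfl
  · exact absurd hneg (hpos i hi).not_gt

/-- Newman's lemma: local confluence together with induction on the number of inversions. -/
theorem terminal_unique (hR : C.IsFiniteRootSystem R) (hh : C.IsHeight R h) {J : Finset I}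
    {a t t' : A} (ht : Relation.ReflTransGen (C.Descent h J) a t)
    (ht' : Relation.ReflTransGen (C.Descent h J) a t') (hpos : ∀ i ∈ J, 0 < h t (α i))
    (hpos' : ∀ i ∈ J, 0 < h t' (α i)) : t = t' := by
  induction hn : (inversions R h J a).ncard using Nat.strong_induction_on
    generalizing a t t' with
  | _ n ih =>
    rcases ht.cases_head with rfl | ⟨b, ⟨i, hi, hneg, rfl⟩, hb⟩
    · exact (terminal_eq hpos ht').symm
    rcases ht'.cases_head with rfl | ⟨b', ⟨j, hj, hneg', rfl⟩, hb'⟩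
    · exact terminal_eq hpos' ht
    obtain ⟨c, hc, hc'⟩ := descent_locally_confluent hR hh hi hj hneg hneg'
    obtain ⟨s, hs, hspos⟩ := exists_terminal hR hh J c
    have h1 := ncard_inversions_ρ hR hh hi hneg
    have h2 := ncard_inversions_ρ hR hh hj hneg'
    exact (ih _ (by omega) hb (hc.trans hs) hpos hspos rfl).trans
      (ih _ (by omega) hb' (hc'.trans hs) hpos' hspos rfl).symm

/-- Every residue of type `J` has a unique element at which all elements of `J` are ascents. -/
theorem exists_minimal (hR : C.IsFiniteRootSystem R) (hh : C.IsHeight R h) (J : Finset I) :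
    ∃ N : A → A, (∀ a, Relation.ReflTransGen (C.Descent h J) a (N a)) ∧
      (∀ a, ∀ i ∈ J, 0 < h (N a) (α i)) ∧ (∀ a, ∀ i ∈ J, N (C.ρ i a) = N a) ∧
      ∀ a, (∀ i ∈ J, 0 < h a (α i)) → N a = a := by
  choose N hN hpos using exists_terminal hR hh J
  have key : ∀ a, ∀ i ∈ J, h a (α i) < 0 → N (C.ρ i a) = N a := fun a i hi hneg =>
    terminal_unique hR hh (.head ⟨i, hi, hneg, rfl⟩ (hN (C.ρ i a))) (hN a) (hpos _) (hpos _)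
  refine ⟨N, hN, hpos, fun a i hi => ?_, fun a ha => terminal_eq ha (hN a)⟩
  rcases hh.lt_or_gt hR.toIsRootSystem a i with hneg | hpos'
  · exact key a i hi hneg
  -- An ascent at `a` is a descent at the other end of the edge.
  · have := key (C.ρ i a) i hi (by rw [hh.apply_ρ_α]; omega)
    rwa [C.ρ_ρ, eq_comm] at this

/-- By connectedness all objects form a single residue for the full label set. -/
theorem existsUnique_forall_pos (hR : C.IsFiniteRootSystem R) (hh : C.IsHeight R h)
    (hconn : C.IsConnected) : ∃! a, ∀ i, 0 < h a (α i) := by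
  obtain ⟨N, -, hpos, hρ, hfix⟩ := exists_minimal hR hh Finset.univ
  have hmor : ∀ (a b : A) (w), C.IsMorphism a b w → N b = N a := by
    intro a b w hw
    induction hw with
    | id => rfl
    | step b w i _ ih => rw [hρ _ _ (Finset.mem_univ i), ih]
  obtain ⟨a⟩ := ‹Nonempty A›
  refine ⟨N a, fun i => hpos a i (Finset.mem_univ i), fun b hb => ?_⟩
  obtain ⟨w⟩ := hconn a b
  rw [← hfix b fun i _ => hb i, hmor a b w.1 w.2]

/-! ### Counting edges and faces by ascents. -/

/-- The set of ascents at `a`. -/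
noncomputable def ascents (h : A → Module.Dual ℤ (I → ℤ)) (a : A) : Finset I :=
  {i | 0 < h a (α i)}

theorem mem_ascents {a : A} {i : I} : i ∈ ascents h a ↔ 0 < h a (α i) := by
  simp [ascents]

theorem subset_ascents {a : A} {J : Finset I} :
    J ⊆ ascents h a ↔ ∀ i ∈ J, 0 < h a (α i) := by
  simp [Finset.subset_iff, mem_ascents]

theorem IsHeight.ρ_ne (hR : C.IsRootSystem R) (hh : C.IsHeight R h) (a : A) (i : I) :
    a ≠ C.ρ i a := by
  intro heq
  have h1 := hh.apply_ρ_α a i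
  have h2 := hh.ne_zero a _ (hR.α_mem a i)
  rw [← heq] at h1
  omega

theorem edgeSet_eq_image (hR : C.IsFiniteRootSystem R) (hh : C.IsHeight R h) [Fintype A] :
    E(C.objectChangeDiagram) =
      (fun p : Σ _ : A, I => (p.2, s(p.1, C.ρ p.2 p.1))) ''
        ((Finset.univ.sigma fun a => ascents h a : Finset (Σ _ : A, I)) : Set (Σ _ : A, I)) := by
  ext ⟨i, e⟩
  rw [Graph.edge_mem_iff_exists_isLink]
  constructor
  · rintro ⟨a, b, hab, hne, he⟩
    dsimp only at hab he
    subst hab he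
    rcases hh.lt_or_gt hR.toIsRootSystem a i with hneg | hpos
    · refine ⟨⟨C.ρ i a, i⟩, ?_, ?_⟩
      · simpa [mem_ascents, hh.apply_ρ_α] using hneg
      · simp [C.ρ_ρ, Sym2.eq_swap]
    · exact ⟨⟨a, i⟩, by simpa [mem_ascents] using hpos, rfl⟩
  · rintro ⟨⟨a, j⟩, -, heq⟩
    obtain ⟨rfl, rfl⟩ := Prod.mk.inj heq
    exact ⟨a, C.ρ j a, rfl, hh.ρ_ne hR.toIsRootSystem a j, rfl⟩

/-- Each edge is counted at the one endpoint where its label is an ascent; the height of `α i` has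
opposite signs at the two ends. -/
theorem ncard_edgeSet (hR : C.IsFiniteRootSystem R) (hh : C.IsHeight R h) [Fintype A] :
    E(C.objectChangeDiagram).ncard = ∑ a, (ascents h a).card := by
  rw [edgeSet_eq_image hR hh, Set.InjOn.ncard_image, Set.ncard_coe_finset,
    Finset.card_sigma]
  rintro ⟨a, i⟩ ha ⟨b, j⟩ hb heq
  obtain ⟨rfl, heq⟩ := Prod.mk.inj heq
  dsimp only at heq ha hb ⊢
  rcases Sym2.eq_iff.1 heq with ⟨rfl, -⟩ | ⟨rfl, -⟩
  · rfl
  · simp only [Finset.coe_sigma, Set.mem_sigma_iff, Finset.mem_coe, mem_ascents,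
      hh.apply_ρ_α] at ha hb
    omega

theorem eqvGen_sameFace_of_pair_eq {i j i' j' : I} {hij : i ≠ j} {hij' : i' ≠ j'}
    (heq : ({i, j} : Finset I) = {i', j'}) (a : A) :
    Relation.EqvGen C.SameFace ⟨(i, j, a), hij⟩ ⟨(i', j', a), hij'⟩ := by
  refine .rel _ _ ⟨?_, 0, .inl rfl⟩
  simpa using congrArg (fun s : Finset I => (s : Set I)) heq

theorem eqvGen_sameFace_of_descent {i j : I} (hij : i ≠ j) {a c : A}
    (hac : Relation.ReflTransGen (C.Descent h {i, j}) a c) :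
    Relation.EqvGen C.SameFace ⟨(i, j, a), hij⟩ ⟨(i, j, c), hij⟩ := by
  induction hac with
  | refl => exact .refl _
  | @tail b c _ hbc ih =>
    refine ih.trans _ _ _ ?_
    obtain ⟨k, hk, -, rfl⟩ := hbc
    rcases Finset.mem_insert.1 hk with rfl | hk
    · exact .rel _ _ ⟨rfl, 0, .inr rfl⟩
    · rw [Finset.mem_singleton.1 hk]
      -- With `m = 0` the relation moves only along the first label, so the labels are swapped
      -- first.
      refine .trans _ ⟨(j, i, b), hij.symm⟩ _
        (eqvGen_sameFace_of_pair_eq (Finset.pair_comm i j) b) (.rel _ _ ⟨?_, 0, .inr rfl⟩)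
      exact Set.pair_comm j i

/-- A face corresponds to the minimum of its residue together with its pair of labels, both ascents
there. -/
theorem exists_face_equiv (hR : C.IsFiniteRootSystem R) (hh : C.IsHeight R h) [Fintype A] :
    Nonempty (C.Face ≃
      (Finset.univ.sigma fun a => (ascents h a).powersetCard 2 : Finset (Σ _ : A, Finset I))) := by
  choose N hN hpos hρ hfix using exists_minimal hR hh
  let F : FaceTriple I A → Σ _ : A, Finset I := fun t =>
    ⟨N {t.1.1, t.1.2.1} t.1.2.2, {t.1.1, t.1.2.1}⟩
  have hiter : ∀ (i j : I) (m : ℕ) (a : A),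
      N {i, j} ((C.ρ j ∘ C.ρ i)^[m] a) = N {i, j} a := by
    intro i j m
    induction m with
    | zero => intro a; rfl
    | succ m ih =>
      intro a
      rw [Function.iterate_succ_apply, ih, Function.comp_apply, hρ _ _ j (by simp),
        hρ _ _ i (by simp)]
  have hF : ∀ s t, Relation.EqvGen C.SameFace s t → F s = F t := by
    intro s t hst
    induction hst with
    | rel s t hst =>
      obtain ⟨⟨i, j, a⟩, hij⟩ := s
      obtain ⟨⟨i', j', b⟩, hij'⟩ := t
      obtain ⟨heq, m, hm⟩ := hst
      have heq' : ({i, j} : Finset I) = {i', j'} := Finset.coe_injective (by simpa using heq)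
      have hb : N {i, j} b = N {i, j} a := by
        rcases hm with rfl | rfl
        · exact hiter i j m a
        · exact (hρ _ _ i (by simp)).trans (hiter i j m a)
      simp only [F, ← heq', hb]
    | refl => rfl
    | symm _ _ _ ih => exact ih.symm
    | trans _ _ _ _ _ ih ih' => exact ih.trans ih'
  have hmem : ∀ t, F t ∈ (Finset.univ.sigma fun a => (ascents h a).powersetCard 2 :
      Finset (Σ _ : A, Finset I)) := by
    intro t
    simp only [F, Finset.mem_sigma, Finset.mem_univ, true_and, Finset.mem_powersetCard]
    exact ⟨subset_ascents.2 (hpos _ _), Finset.card_pair t.2⟩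
  refine ⟨Equiv.ofBijective (Quotient.lift (fun t => ⟨F t, hmem t⟩)
    fun s t hst => Subtype.ext (hF s t hst)) ⟨?_, ?_⟩⟩
  · intro x y
    refine Quotient.inductionOn₂ x y ?_
    rintro ⟨⟨i, j, a⟩, hij⟩ ⟨⟨i', j', b⟩, hij'⟩ heq
    obtain ⟨h1, h2⟩ : N {i, j} a = N {i', j'} b ∧ ({i, j} : Finset I) = {i', j'} := by
      simpa [F] using heq
    refine Quotient.sound (.trans _ _ _ (eqvGen_sameFace_of_descent hij (hN _ a)) ?_)
    rw [h1]
    exact .trans _ _ _ (eqvGen_sameFace_of_pair_eq h2 _)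
      (.symm _ _ (eqvGen_sameFace_of_descent hij' (hN _ b)))
  · rintro ⟨⟨a, P⟩, hP⟩
    have hP' := hP
    simp only [Finset.mem_sigma, Finset.mem_univ, true_and, Finset.mem_powersetCard] at hP'
    obtain ⟨hsub, hcard⟩ := hP'
    obtain ⟨i, j, hij, rfl⟩ := Finset.card_eq_two.1 hcard
    refine ⟨Quotient.mk _ ⟨(i, j, a), hij⟩, Subtype.ext ?_⟩
    simp [F, hfix _ _ (subset_ascents.1 hsub)]

theorem euler_characteristic_of_height (hrank : Fintype.card I = 3)
    (hR : C.IsFiniteRootSystem R) (hh : C.IsHeight R h) (hconn : C.IsConnected) [Finite A] :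
    V(C.objectChangeDiagram).Finite ∧ E(C.objectChangeDiagram).Finite ∧ Finite C.Face ∧
      (V(C.objectChangeDiagram).ncard : ℤ) - E(C.objectChangeDiagram).ncard
        + Nat.card C.Face = 2 := by
  have := Fintype.ofFinite A
  obtain ⟨φ⟩ := exists_face_equiv hR hh
  refine ⟨Set.toFinite _, Set.toFinite _, .of_equiv _ φ.symm, ?_⟩
  have hV : V(C.objectChangeDiagram).ncard = Fintype.card A := by
    rw [← Nat.card_eq_fintype_card]; exact Set.ncard_univ A
  rw [ncard_edgeSet hR hh, Nat.card_congr φ, Nat.card_eq_fintype_card, Fintype.card_coe,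
    Finset.card_sigma, hV]
  have hmin : ∃! a, (ascents h a).card = 3 := by
    have := existsUnique_forall_pos hR hh hconn
    simpa only [← hrank, Finset.card_eq_iff_eq_univ, Finset.eq_univ_iff_forall,
      mem_ascents] using this
  -- Negating the height exchanges ascents and descents.
  have hmax : ∃! a, (ascents h a).card = 0 := by
    have := existsUnique_forall_pos hR hh.neg hconn
    have hiff : ∀ a i, 0 < (-h) a (α i) ↔ ¬ 0 < h a (α i) := by
      intro a i
      have h0 := hh.ne_zero a _ (hR.α_mem a i)
      rw [Pi.neg_apply, LinearMap.neg_apply]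
      omega
    simpa only [Finset.card_eq_zero, Finset.eq_empty_iff_forall_notMem, mem_ascents,
      hiff] using this
  have hterm : ∀ a, (1 : ℤ) - (ascents h a).card + ((ascents h a).card.choose 2 : ℕ) =
      (if (ascents h a).card = 3 then 1 else 0) + (if (ascents h a).card = 0 then 1 else 0) := by
    intro a
    have hle : (ascents h a).card ≤ 3 := hrank ▸ Finset.card_le_univ _
    generalize (ascents h a).card = s at hle
    interval_cases s <;> simp
  have hone : ∀ n, (∃! a, (ascents h a).card = n) →
      ∑ a, (if (ascents h a).card = n then 1 else 0 : ℤ) = 1 := by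
    rintro n ⟨b, hb, huniq⟩
    rw [Finset.sum_eq_single b (fun a _ hne => if_neg fun ha => hne (huniq a ha)) (by simp),
      if_pos hb]
  have hsum := Finset.sum_congr rfl fun a (_ : a ∈ Finset.univ) => hterm a
  rw [Finset.sum_add_distrib, Finset.sum_add_distrib, Finset.sum_sub_distrib, hone 3 hmin,
    hone 0 hmax] at hsum
  simpa [Finset.card_powersetCard] using hsum

end Height

/-! ### The coordinate-sum height and finiteness of the set of objects. -/

section RealRoots

variable {C : CartanScheme I A}

theorem IsSimplyConnected.morphism_unique (hsc : C.IsSimplyConnected) {a b : A}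
    {v w : (I → ℤ) ≃ₗ[ℤ] (I → ℤ)} (hv : C.IsMorphism a b v) (hw : C.IsMorphism a b w) :
    v = w := by
  have h1 : w⁻¹ * v = 1 := congrArg Subtype.val (hsc a ⟨w⁻¹ * v, hv.comp hw.inv⟩)
  exact (inv_mul_eq_one.1 h1).symm

theorem IsMorphism.apply_mem_realRoots {a b : A} {w : (I → ℤ) ≃ₗ[ℤ] (I → ℤ)}
    (hw : C.IsMorphism a b w) {β : I → ℤ} (hβ : β ∈ C.realRoots a) :
    w β ∈ C.realRoots b := by
  obtain ⟨d, v, j, rfl⟩ := hβ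
  exact ⟨d, ⟨w * v.1, v.2.comp hw⟩, j, rfl⟩

theorem realRoots_ne_zero {a : A} {β : I → ℤ} (hβ : β ∈ C.realRoots a) : β ≠ 0 := by
  obtain ⟨d, v, j, rfl⟩ := hβ
  rw [Ne, LinearEquiv.map_eq_zero_iff]
  simp [α]

/-- A root is nonzero and its coordinates do not have mixed signs. -/
theorem sum_ne_zero (hR : C.IsRootSystem C.realRoots) {a : A} {β : I → ℤ}
    (hβ : β ∈ C.realRoots a) : ∑ i, β i ≠ 0 := by
  intro h0
  refine realRoots_ne_zero hβ (funext fun i => ?_)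
  rcases hR.nonneg_or_nonpos hβ with hβ' | hβ'
  · exact (Finset.sum_eq_zero_iff_of_nonneg fun k _ => hβ' k).1 h0 i (Finset.mem_univ i)
  · exact (Finset.sum_eq_zero_iff_of_nonpos fun k _ => hβ' k).1 h0 i (Finset.mem_univ i)

/-- The sum of the coordinates of `w x`, as a linear form in `x`. -/
def heightForm (w : (I → ℤ) ≃ₗ[ℤ] (I → ℤ)) : Module.Dual ℤ (I → ℤ) :=
  (∑ i, LinearMap.proj i) ∘ₗ w.toLinearMap

theorem heightForm_apply (w : (I → ℤ) ≃ₗ[ℤ] (I → ℤ)) (x : I → ℤ) :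
    heightForm w x = ∑ i, w x i := by
  simp [heightForm]

theorem isHeight_heightForm (hsc : C.IsSimplyConnected) (hR : C.IsRootSystem C.realRoots)
    {b : A} {w : A → (I → ℤ) ≃ₗ[ℤ] (I → ℤ)} (hw : ∀ a, C.IsMorphism a b (w a)) :
    C.IsHeight C.realRoots fun a => heightForm (w a) where
  apply_σ a i x := by
    have h1 : C.IsMorphism a (C.ρ i a) (C.σ a i) := by
      simpa using IsMorphism.step a 1 i IsMorphism.id
    rw [heightForm_apply, heightForm_apply,
      ← hsc.morphism_unique (h1.comp (hw (C.ρ i a))) (hw a)]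
    rfl
  ne_zero a β hβ := by
    rw [heightForm_apply]
    exact sum_ne_zero hR ((hw a).apply_mem_realRoots hβ)

theorem IsConnected.exists_morphisms (hconn : C.IsConnected) (b : A) :
    ∃ w : A → (I → ℤ) ≃ₗ[ℤ] (I → ℤ), ∀ a, C.IsMorphism a b (w a) :=
  ⟨fun a => (hconn a b).some.1, fun a => (hconn a b).some.2⟩

/-- At both objects the height based at `b` is the plain coordinate sum, positive on every `α i`, so
both are the unique minimum. -/
theorem eq_of_isMorphism_one (hconn : C.IsConnected) (hsc : C.IsSimplyConnected)
    (hR : C.IsFiniteRootSystem C.realRoots) {a b : A} (hab : C.IsMorphism a b 1) : a = b := by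
  obtain ⟨w, hw⟩ := hconn.exists_morphisms b
  have hpos : ∀ d, C.IsMorphism d b 1 → ∀ i, 0 < heightForm (w d) (α i) := by
    intro d hd i
    rw [heightForm_apply, hsc.morphism_unique (hw d) hd]
    simp [α]
  exact (existsUnique_forall_pos hR (isHeight_heightForm hsc hR.toIsRootSystem hw)
    hconn).unique (hpos a hab) (hpos b .id)

/-- An object is determined by its morphism to `b`, and that morphism by the images of the basis,
which lie in the finite set of roots at `b`. -/
theorem finite_objects (hconn : C.IsConnected) (hsc : C.IsSimplyConnected)
    (hR : C.IsFiniteRootSystem C.realRoots) : Finite A := by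
  obtain ⟨b⟩ := ‹Nonempty A›
  obtain ⟨w, hw⟩ := hconn.exists_morphisms b
  have : Finite (C.realRoots b) := hR.finite b
  refine Finite.of_injective (β := I → C.realRoots b)
    (fun a i => ⟨w a (α i), (hw a).apply_mem_realRoots (hR.α_mem a i)⟩) fun a c hac => ?_
  have heq : w a = w c := by
    ext1 x
    rw [eq_sum_α x, map_sum, map_sum]
    refine Finset.sum_congr rfl fun i _ => ?_
    rw [map_smul, map_smul, show w a (α i) = w c (α i) from congrArg Subtype.val (congrFun hac i)]
  refine eq_of_isMorphism_one hconn hsc hR ?_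
  have := (hw a).comp (hw c).inv
  rwa [heq, inv_mul_cancel] at this

end RealRoots

end CartanScheme

theorem mainTheorem9 {I A : Type*} [Fintype I] [DecidableEq I] [Nonempty I] [Nonempty A]
    (C : CartanScheme I A) (hrank : Fintype.card I = 3)
    (hirr : C.IsIrreducible) (hconn : C.IsConnected) (hsc : C.IsSimplyConnected)
    (hfin : C.IsFiniteRootSystem C.realRoots) :
    V(C.objectChangeDiagram).Finite ∧ E(C.objectChangeDiagram).Finite ∧ Finite C.Face ∧
      (V(C.objectChangeDiagram).ncard : ℤ) - E(C.objectChangeDiagram).ncard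
        + Nat.card C.Face = 2 := by
  obtain ⟨w, hw⟩ := hconn.exists_morphisms (Classical.arbitrary A)
  have := CartanScheme.finite_objects hconn hsc hfin
  exact CartanScheme.euler_characteristic_of_height hrank hfin
    (CartanScheme.isHeight_heightForm hsc hfin.toIsRootSystem hw) hconn
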